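/- Throughout, alphabets are finite non-empty sets. $A^*$ is the set of finite words over $A$ (including the empty word $\varepsilon$) and $A^\omega$ is the set of one-sided infinite words $x_0x_1x_2\cdots$ over $A$. A morphism $f:A^*\to B^*$ is determined by the words $f(a)$, $a\in A$. It acts on infinite words by concatenation, and $y=f(x)$ for $x\in A^\omega$, $y\in B^\omega$ means $y=f(x_0)f(x_1)f(x_2)\cdots$ (in particular the right-hand side is infinite). A substitution on $A$ is a morphism $\tau:A^*\to A^*$ with $\tau(a)\neq\varepsilon$ for all $a\in A$. It is primitive if there is $N\ge 1$ such that $b$ occurs in $\tau^N(a)$ for all $a,b\in A$. A word $y\in B^\omega$ is primitive morphic if there are an alphabet $A$, a morphism $f:A^*\to B^*$ and a word $x\in A^\omega$ such that $y=f(x)$ and $\tau(x)=x$ for some primitive substitution $\tau$ on $A$. A finite word $u$ is rich if it has exactly $|u|+1$ distinct palindromic factors (including $\varepsilon$). An infinite word is rich if all of its finite factors are rich. A morphism $f:A^*\to B^*$ with $f(a)\neq\varepsilon$ for all $a\in A$ is of class $\mathcal P$ if there are palindromes $p$ and $q_a$ ($a\in A$) in $B^*$, possibly empty, with $f(a)=pq_a$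 for all $a\in A$. Morphisms $f,g:A^*\to B^*$ are conjugate if there is $u\in B^*$ such that either $f(a)u=ug(a)$ for all $a\in A$, or $uf(a)=g(a)u$ for all $a\in A$. $\mathcal P'$ is the class of morphisms conjugate to a morphism of class $\mathcal P$. **Theorem.** Let $A$ be an alphabet and let $y\in A^\omega$ be a rich primitive morphic word. Then there exist an alphabet $C$, a morphism $g:C^*\to A^*$ in $\mathcal P'$ and a rich word $x\in C^\omega$ such that $x$ is fixed by some primitive substitution $\tau$ on $C$ with $\tau\in\mathcal P'$, and $y=g(x)$. -/

import Mathlib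

/-! Finite words over `A` are lists, one-sided infinite words are functions `ℕ → A`.
A morphism `A* → B*` is given by its values on letters, `f : A → List B`; its value on a finite
word `w` is the concatenation `w.flatMap f`. -/

namespace RichWords

/-- The factor of length `n` of the infinite word `x` that starts at position `i`. -/
def factorAt {A : Type*} (x : ℕ → A) (i n : ℕ) : List A :=
  (List.range n).map fun j => x (i + j)

/-- The set of palindromic factors of a finite word, the empty word included. -/
def palFactors {A : Type*} (w : List A) : Set (List A) :=
  {p | p <:+: w ∧ p.Palindrome}

theorem palFactors_finite {A : Type*} (w : List A) : (palFactors w).Finite :=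
  (List.finite_toSet w.sublists).subset fun _ hp => List.mem_sublists.2 hp.1.sublist

/-- A finite word `w` is rich if it has exactly `|w| + 1` distinct palindromic factors. -/
def IsRichWord {A : Type*} (w : List A) : Prop :=
  (palFactors w).ncard = w.length + 1

/-- An infinite word is rich if all of its factors are rich. -/
def IsRich {A : Type*} (x : ℕ → A) : Prop :=
  ∀ i n : ℕ, IsRichWord (factorAt x i n)

/-- `IsImage f x y` says that `y = f(x)`: the images of the prefixes of `x` are prefixes of `y`,
and their lengths are unbounded. -/
def IsImage {A B : Type*} (f : A → List B) (x : ℕ → A) (y : ℕ → B) : Prop :=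
  (∀ n : ℕ, (factorAt x 0 n).flatMap f = factorAt y 0 ((factorAt x 0 n).flatMap f).length) ∧
    ∀ N : ℕ, ∃ n : ℕ, N ≤ ((factorAt x 0 n).flatMap f).length

/-- The image of an infinite word under a morphism is unique. -/
theorem IsImage.unique {A B : Type*} {f : A → List B} {x : ℕ → A} {y z : ℕ → B}
    (hy : IsImage f x y) (hz : IsImage f x z) : y = z := by
  funext k
  obtain ⟨n, hn⟩ := hy.2 (k + 1)
  have h := (hy.1 n).symm.trans (hz.1 n)
  have hk : k ∈ List.range ((factorAt x 0 n).flatMap f).length := List.mem_range.2 hn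
  simpa using List.map_inj_left.1 h k hk

/-- A morphism is non-erasing if no letter is mapped to the empty word. A substitution on `A` is a
non-erasing morphism from `A*` to itself. -/
def NonErasing {A B : Type*} (f : A → List B) : Prop :=
  ∀ a, f a ≠ []

/-- A substitution `τ` is primitive if for some `N ≥ 1` every letter occurs in every `τ^N(a)`. -/
def IsPrimitiveSubstitution {A : Type*} (τ : A → List A) : Prop :=
  NonErasing τ ∧ ∃ N : ℕ, 0 < N ∧ ∀ a b : A, b ∈ (fun w : List A => w.flatMap τ)^[N] [a]

/-- `x` is pure primitive morphic: it is a fixed point of a primitive substitution. -/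
def IsPurePrimitiveMorphic {A : Type*} (x : ℕ → A) : Prop :=
  ∃ τ : A → List A, IsPrimitiveSubstitution τ ∧ IsImage τ x x

/-- `y` is primitive morphic: it is the image under a (possibly erasing) morphism of a pure
primitive morphic word over some finite alphabet. -/
def IsPrimitiveMorphic {B : Type*} (y : ℕ → B) : Prop :=
  ∃ (A : Type) (_ : Finite A) (f : A → List B) (x : ℕ → A),
    IsPurePrimitiveMorphic x ∧ IsImage f x y

/-- Class P: the non-erasing morphisms `a ↦ p q_a` with `p` and all the `q_a` palindromes
(possibly empty). -/
def ClassP {A B : Type*} (f : A → List B) : Prop :=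
  NonErasing f ∧ ∃ (p : List B) (q : A → List B),
    p.Palindrome ∧ (∀ a, (q a).Palindrome) ∧ ∀ a, f a = p ++ q a

/-- Conjugate morphisms. -/
def Conjugate {A B : Type*} (f g : A → List B) : Prop :=
  ∃ u : List B, (∀ a, f a ++ u = u ++ g a) ∨ (∀ a, u ++ f a = g a ++ u)

/-- Class P′: the morphisms conjugate to a morphism of class P. -/
def ClassPPrime {A B : Type*} (f : A → List B) : Prop :=
  ∃ g : A → List B, ClassP g ∧ Conjugate f g

/-- `x` is fixed by a primitive substitution in class P′. -/
def FPPrime {A : Type*} (x : ℕ → A) : Prop :=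
  ∃ τ : A → List A, IsPrimitiveSubstitution τ ∧ ClassPPrime τ ∧ IsImage τ x x

end RichWords

/-!
A complete return to a palindrome in a rich word is a palindrome (`IsRich.palReturns`), and
conversely this property gives richness (`PalReturns.isRich`). Hence in a recurrent rich word the
complete return to a palindromic prefix is a longer palindromic prefix, and `y` has arbitrarily long
palindromic prefixes.

Fix a palindromic prefix `w` of `y`. Cutting `y` at the occurrences of `w` writes `y` as a sequence
of return words to `w`; coding the return words by letters gives the derived sequence of `y` with
respect to `w`. Factors of the derived sequence correspond to factors of `y` that begin and end with
`w`, and in this correspondence palindromes match palindromes (`Recurrent.palAt_derived`,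
`Recurrent.palAt_of_derived`), so the derived sequence is rich (`Recurrent.palReturns_derived`). For
a return word `r` the word `rw` is a palindrome, and a morphism `f` for which `w` and all `f(a)w` are
palindromes is conjugate, by the first half of `w`, to a morphism of class P
(`classPPrime_of_palindrome`).

A primitive morphic word is parsed at every scale `n` by one fixed sequence `x` over a finite
alphabet, into words of length comparable to `n` (`IsImage.scalableParsing`), so it is linearly
recurrent. If `y` is not periodic, return words to a prefix of length `n` have length comparable to
`n`, and a derived sequence is the image of the sequence of pairs of consecutive letters of `x` by a
morphism taken from a finite set that does not depend on `n`
(`LinearlyRecurrent.exists_isImage_derived`). This is Durand's theorem that `y` has finitely many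
derived sequences, so infinitely many palindromic prefixes share one derived sequence `u`. Comparing
a short prefix of this kind with a much longer one gives a substitution that fixes `u`. It is
primitive, as a return word to the long prefix contains all the return words to the short one, and
it lies in class P′ by the same criterion, applied to the coding of the long prefix
(`exists_of_aperiodic`). A periodic `y` is the image of a constant sequence (`exists_of_periodic`).
-/

namespace RichWords

/-! ### Factors and palindromes by positions -/

/-- The factor of `y` of length `n` at position `i` is a palindrome: positions `a` and `b` with
`a + b + 1 = n` carry the same letter. -/
def PalAt {A : Type*} (y : ℕ → A) (i n : ℕ) : Prop :=
  ∀ a b, a + b + 1 = n → y (i + a) = y (i + b)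

/-- The factors of `y` of length `n` at positions `i` and `j` are equal. -/
def Agree {A : Type*} (y : ℕ → A) (i j n : ℕ) : Prop :=
  ∀ t < n, y (i + t) = y (j + t)

theorem PalAt.eq {A : Type*} {y : ℕ → A} {i n p q : ℕ} (h : PalAt y i n)
    (hp : i ≤ p) (hq : i ≤ q) (hpq : p + q + 1 = 2 * i + n) : y p = y q := by
  obtain ⟨a, rfl⟩ := Nat.exists_eq_add_of_le hp
  obtain ⟨b, rfl⟩ := Nat.exists_eq_add_of_le hq
  exact h a b (by omega)

theorem Agree.eq {A : Type*} {y : ℕ → A} {i j n p q : ℕ} (h : Agree y i j n)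
    (hp : i ≤ p) (hn : p < i + n) (hpq : p + j = q + i) : y p = y q := by
  obtain ⟨a, rfl⟩ := Nat.exists_eq_add_of_le hp
  obtain rfl : q = j + a := by omega
  exact h a (by omega)

theorem Agree.symm {A : Type*} {y : ℕ → A} {i j n : ℕ} (h : Agree y i j n) : Agree y j i n :=
  fun t ht => (h t ht).symm

theorem Agree.mono {A : Type*} {y : ℕ → A} {i j m n : ℕ} (h : Agree y i j n) (hm : m ≤ n) :
    Agree y i j m :=
  fun t ht => h t (ht.trans_le hm)

@[simp] theorem length_factorAt {A : Type*} (y : ℕ → A) (i n : ℕ) :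
    (factorAt y i n).length = n := by
  simp [factorAt]

@[simp] theorem getElem_factorAt {A : Type*} (y : ℕ → A) (i n k : ℕ)
    (hk : k < (factorAt y i n).length) : (factorAt y i n)[k] = y (i + k) := by
  simp [factorAt]

theorem factorAt_eq_iff {A : Type*} {y z : ℕ → A} {i j n : ℕ} :
    factorAt y i n = factorAt z j n ↔ ∀ t < n, y (i + t) = z (j + t) := by
  simp [factorAt]

theorem factorAt_append {A : Type*} (y : ℕ → A) (i m n : ℕ) :
    factorAt y i m ++ factorAt y (i + m) n = factorAt y i (m + n) := by
  simp [factorAt, List.range_add, Function.comp_def, add_assoc]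

theorem factorAt_succ {A : Type*} (y : ℕ → A) (i n : ℕ) :
    factorAt y i (n + 1) = factorAt y i n ++ [y (i + n)] := by
  simp [factorAt, List.range_succ]

theorem mem_factorAt {A : Type*} {y : ℕ → A} {i n : ℕ} {a : A} :
    a ∈ factorAt y i n ↔ ∃ t < n, y (i + t) = a := by
  simp [factorAt]

theorem palindrome_factorAt {A : Type*} {y : ℕ → A} {i n : ℕ} :
    (factorAt y i n).Palindrome ↔ PalAt y i n := by
  constructor
  · intro hpal a b hab
    have h := hpal.reverse_eq
    have h1 : (factorAt y i n).reverse[a]? = (factorAt y i n)[a]? := by rw [h]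
    rw [List.getElem?_reverse (by simp; omega)] at h1
    rw [List.getElem?_eq_getElem (by simp; omega), List.getElem?_eq_getElem (by simp; omega)] at h1
    simp only [getElem_factorAt, length_factorAt, Option.some.injEq] at h1
    rw [← h1]
    congr 1
    omega
  · intro h
    apply List.Palindrome.of_reverse_eq
    apply List.ext_getElem
    · simp
    · intro k hk1 hk2
      simp only [List.length_reverse, length_factorAt] at hk1
      simp only [List.getElem_reverse, getElem_factorAt, length_factorAt]
      exact h _ _ (by omega)

theorem infix_factorAt_iff {A : Type*} {y : ℕ → A} {i n : ℕ} {p : List A} :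
    p <:+: factorAt y i n ↔ ∃ k m, k + m ≤ n ∧ p = factorAt y (i + k) m := by
  constructor
  · rintro ⟨s, t, h⟩
    have hl : s.length + p.length + t.length = n := by
      simpa [add_assoc] using congrArg List.length h
    refine ⟨s.length, p.length, by omega, ?_⟩
    have h2 : s ++ (p ++ t) = factorAt y i s.length ++ (factorAt y (i + s.length) p.length ++
        factorAt y (i + s.length + p.length) t.length) := by
      rw [factorAt_append, factorAt_append, ← List.append_assoc, h]
      congr 1
      omega
    have h3 := (List.append_inj h2 (by simp)).2
    exact (List.append_inj h3 (by simp)).1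
  · rintro ⟨k, m, hkm, rfl⟩
    refine ⟨factorAt y i k, factorAt y (i + k + m) (n - k - m), ?_⟩
    rw [factorAt_append, add_assoc, factorAt_append]
    congr 1
    omega

/-! ### Richness and complete returns -/

/-- Every complete return to a palindromic factor is a palindrome: if a palindrome of length `n` at
position `i` occurs next at position `i + d`, then the factor that covers both occurrences is a
palindrome. -/
def PalReturns {A : Type*} (y : ℕ → A) : Prop :=
  ∀ i d n, 0 < d → PalAt y i n → Agree y (i + d) i n →
    (∀ e, 0 < e → e < d → ¬ Agree y (i + e) i n) → PalAt y i (d + n)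

theorem mem_palFactors_factorAt {A : Type*} {y : ℕ → A} {i n : ℕ} {p : List A} :
    p ∈ palFactors (factorAt y i n) ↔
      ∃ k m, k + m ≤ n ∧ p = factorAt y (i + k) m ∧ PalAt y (i + k) m := by
  rw [palFactors, Set.mem_ofPred_eq, infix_factorAt_iff]
  constructor
  · rintro ⟨⟨k, m, h, rfl⟩, h2⟩
    exact ⟨k, m, h, rfl, palindrome_factorAt.1 h2⟩
  · rintro ⟨k, m, h, rfl, h2⟩
    exact ⟨⟨k, m, h, rfl⟩, palindrome_factorAt.2 h2⟩

/-- A complete return has one palindromic factor more than the word without its last letter. That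
palindrome is a suffix; it cannot be shorter than the whole return, as the palindrome returned to
would then occur in between or it would have occurred before. -/
theorem IsRich.palReturns {A : Type*} {y : ℕ → A} (h : IsRich y) : PalReturns y := by
  intro i d n hd hpal hagree hno
  have h1 : ¬ palFactors (factorAt y i (d + n)) ⊆ palFactors (factorAt y i (d + n - 1)) := by
    intro hsub
    have h2 := Set.ncard_le_ncard hsub (palFactors_finite _)
    rw [h i (d + n), h i (d + n - 1)] at h2
    simp only [length_factorAt] at h2
    omega
  obtain ⟨p, hp, hp'⟩ := Set.not_subset.1 h1
  obtain ⟨k, m, hkm, rfl, hpm⟩ := mem_palFactors_factorAt.1 hp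
  rw [mem_palFactors_factorAt] at hp'
  have hkm' : k + m = d + n := by
    by_contra hne
    exact hp' ⟨k, m, by omega, rfl, hpm⟩
  rcases Nat.lt_or_ge n m with hnm | hnm
  · rcases Nat.eq_zero_or_pos k with rfl | hk
    · simpa [← hkm'] using hpm
    · refine absurd ?_ (hno k hk (by omega))
      intro t ht
      calc y (i + k + t) = y (i + d + (n - 1 - t)) := hpm.eq (by omega) (by omega) (by omega)
        _ = y (i + (n - 1 - t)) := hagree _ (by omega)
        _ = y (i + t) := hpal _ _ (by omega)
  · have h3 : ∀ t < m, y (i + k + t) = y (i + (n - m) + t) := fun t ht =>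
      hagree.eq (by omega) (by omega) (by omega)
    refine absurd ⟨n - m, m, by omega, factorAt_eq_iff.2 h3, ?_⟩ hp'
    intro a b hab
    rw [← h3 a (by omega), ← h3 b (by omega)]
    exact hpm a b hab

/-- Each new letter creates exactly one new palindrome, the longest palindromic suffix: by
`PalReturns` it has not occurred before, as the complete return to its previous occurrence would be
a longer palindromic suffix. -/
theorem PalReturns.isRich {A : Type*} {y : ℕ → A} (h : PalReturns y) : IsRich y := by
  intro i n
  induction n with
  | zero =>
    have : palFactors (factorAt y i 0) = {[]} := by
      ext p
      simp only [palFactors, factorAt, List.range_zero, List.map_nil, List.infix_nil,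
        Set.mem_ofPred_eq, Set.mem_singleton_iff]
      exact ⟨fun hp => hp.1, fun hp => ⟨hp, hp ▸ List.Palindrome.nil⟩⟩
    simp [IsRichWord, this]
  | succ n ih =>
    classical
    have hex : ∃ k, k ≤ n ∧ PalAt y (i + k) (n + 1 - k) :=
      ⟨n, le_rfl, fun a b hab => by
        obtain rfl : a = 0 := by omega
        obtain rfl : b = 0 := by omega
        rfl⟩
    obtain ⟨hkn, hk⟩ := Nat.find_spec hex
    have hmin : ∀ j < Nat.find hex, ¬ PalAt y (i + j) (n + 1 - j) := fun j hj hpal =>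
      Nat.find_min hex hj ⟨by omega, hpal⟩
    generalize Nat.find hex = k at hkn hk hmin
    have hnew : factorAt y (i + k) (n + 1 - k) ∉ palFactors (factorAt y i n) := by
      intro hmem
      obtain ⟨j, m, hjm, heq, -⟩ := mem_palFactors_factorAt.1 hmem
      obtain rfl : n + 1 - k = m := by simpa using congrArg List.length heq
      have hagree := factorAt_eq_iff.1 heq
      -- the least such `d` is the distance to the last earlier occurrence
      have hexd : ∃ d, 0 < d ∧ d ≤ k ∧ Agree y (i + (k - d) + d) (i + (k - d)) (n + 1 - k) :=
        ⟨k - j, by omega, by omega, fun t ht => by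
          rw [show i + (k - (k - j)) + (k - j) + t = i + k + t by omega,
            show i + (k - (k - j)) + t = i + j + t by omega]
          exact hagree t ht⟩
      obtain ⟨hd, hdk, hag⟩ := Nat.find_spec hexd
      have hdmin := fun e (he : e < Nat.find hexd) => Nat.find_min hexd he
      generalize Nat.find hexd = d at hd hdk hag hdmin
      refine hmin (k - d) (by omega) ?_
      rw [show n + 1 - (k - d) = d + (n + 1 - k) by omega]
      refine h _ d _ hd (fun a b hab => ?_) hag fun e he hed hag' => ?_
      · rw [← hag a (by omega), ← hag b (by omega)]
        exact hk.eq (by omega) (by omega) (by omega)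
      · refine hdmin (d - e) (by omega) ⟨by omega, by omega, fun t ht => ?_⟩
        rw [show i + (k - (d - e)) + (d - e) + t = i + (k - d) + d + t by omega, hag t ht,
          ← hag' t ht]
        congr 1
        omega
    have hins : palFactors (factorAt y i (n + 1)) =
        insert (factorAt y (i + k) (n + 1 - k)) (palFactors (factorAt y i n)) := by
      ext p
      rw [Set.mem_insert_iff]
      constructor
      · intro hp
        obtain ⟨j, m, hjm, rfl, hpm⟩ := mem_palFactors_factorAt.1 hp
        rcases Nat.lt_or_ge n (j + m) with hlt | hle
        · obtain rfl : m = n + 1 - j := by omega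
          rcases Nat.lt_trichotomy j k with hjk | rfl | hjk
          · exact absurd hpm (hmin j hjk)
          · exact Or.inl rfl
          · right
            have hsame : ∀ t < n + 1 - j, y (i + j + t) = y (i + k + t) := fun t ht =>
              calc y (i + j + t) = y (i + n - t) := hpm.eq (by omega) (by omega) (by omega)
                _ = y (i + k + t) := hk.eq (by omega) (by omega) (by omega)
            refine mem_palFactors_factorAt.2 ⟨k, n + 1 - j, by omega,
              factorAt_eq_iff.2 hsame, fun a b hab => ?_⟩
            rw [← hsame a (by omega), ← hsame b (by omega)]
            exact hpm a b hab
        · exact Or.inr (mem_palFactors_factorAt.2 ⟨j, m, hle, rfl, hpm⟩)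
      · rintro (rfl | hp)
        · exact mem_palFactors_factorAt.2 ⟨k, _, by omega, rfl, hk⟩
        · obtain ⟨j, m, hjm, rfl, hpm⟩ := mem_palFactors_factorAt.1 hp
          exact mem_palFactors_factorAt.2 ⟨j, m, by omega, rfl, hpm⟩
    rw [IsRichWord] at ih ⊢
    rw [hins, Set.ncard_insert_of_notMem hnew (palFactors_finite _), ih]
    simp

/-! ### A criterion for class P′ -/

theorem _root_.List.Palindrome.exists_half {A : Type*} {w : List A} (hw : w.Palindrome) :
    ∃ v c : List A, w = v ++ c ++ v.reverse ∧ (c = [] ∨ ∃ b, c = [b]) := by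
  induction hw with
  | nil => exact ⟨[], [], by simp⟩
  | singleton b => exact ⟨[], [b], by simp⟩
  | cons_concat b _ ih =>
    obtain ⟨v, c, rfl, hc⟩ := ih
    exact ⟨b :: v, c, by simp, hc⟩

/-- If `w` and all the words `f(a)w` are palindromes, then `f` is conjugate, by the first half of
`w`, to a morphism of class P whose common prefix `p` is the central letter of `w`, or empty. -/
theorem classPPrime_of_palindrome {A C : Type*} {f : C → List A} {w : List A}
    (hf : NonErasing f) (hw : w.Palindrome) (h : ∀ a, (f a ++ w).Palindrome) :
    ClassPPrime f := by
  obtain ⟨v, c, hwv, hc⟩ := hw.exists_half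
  have hcp : c.reverse = c := by rcases hc with rfl | ⟨b, rfl⟩ <;> rfl
  have hpre : ∀ a, ∃ g, f a ++ v = v ++ g := by
    intro a
    have h1 : v <+: f a ++ w := by
      have := (h a).reverse_eq
      rw [List.reverse_append, hw.reverse_eq] at this
      rw [← this, hwv]
      simp only [List.append_assoc]
      exact List.prefix_append _ _
    have h2 : f a ++ v <+: f a ++ w := by
      rw [hwv]
      simp only [← List.append_assoc]
      rw [List.append_assoc]
      exact List.prefix_append _ _
    obtain ⟨g, hg⟩ := List.prefix_of_prefix_length_le h1 h2 (by simp)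
    exact ⟨g, hg.symm⟩
  choose g hg using hpre
  have hgc : ∀ a, (g a ++ c).reverse = g a ++ c := by
    intro a
    have h1 := (h a).reverse_eq
    have h2 : f a ++ w = v ++ (g a ++ c) ++ v.reverse := by
      rw [hwv]
      simp only [← List.append_assoc]
      rw [hg a]
    rw [h2] at h1
    simp only [List.reverse_append, List.reverse_reverse, List.append_assoc,
      List.append_cancel_left_eq] at h1 ⊢
    simpa only [← List.append_assoc, List.append_cancel_right_eq] using h1
  have hgne : ∀ a, g a ≠ [] := by
    intro a h0
    have := congrArg List.length (hg a)
    simp only [List.length_append, h0, List.length_nil] at this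
    exact hf a (List.length_eq_zero_iff.1 (by omega))
  refine ⟨g, ⟨hgne, ?_⟩, v, Or.inl hg⟩
  rcases hc with rfl | ⟨b, rfl⟩
  · refine ⟨[], g, List.Palindrome.nil, fun a => ?_, fun a => rfl⟩
    exact List.Palindrome.of_reverse_eq (by simpa using hgc a)
  · refine ⟨[b], fun a => (g a).tail, List.Palindrome.singleton b, fun a => ?_, fun a => ?_⟩
    · have h1 := hgc a
      obtain ⟨e, q, hga⟩ := List.exists_cons_of_ne_nil (hgne a)
      simp only [hga, List.reverse_append, List.reverse_cons, List.reverse_nil, List.nil_append,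
        List.cons_append, List.cons.injEq] at h1
      simp only [hga, List.tail_cons]
      exact List.Palindrome.of_reverse_eq (List.append_inj h1.2 (by simp)).1
    · have h1 := hgc a
      obtain ⟨e, q, hga⟩ := List.exists_cons_of_ne_nil (hgne a)
      simp only [hga, List.reverse_append, List.reverse_cons, List.reverse_nil, List.nil_append,
        List.cons_append, List.cons.injEq] at h1
      simp [hga, h1.1]

/-! ### Derived sequences -/

/-- Every prefix of `y` occurs arbitrarily far in `y`. -/
def Recurrent {A : Type*} (y : ℕ → A) : Prop :=
  ∀ n N, ∃ i, N ≤ i ∧ Agree y i 0 n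

/-- The position of the occurrence number `k`, counted from `0`, of the prefix of length `n`. -/
noncomputable def cut {A : Type*} (y : ℕ → A) (n k : ℕ) : ℕ :=
  Nat.nth (fun i => Agree y i 0 n) k

/-- The return word number `k` to the prefix of length `n`: the factor between the occurrences
number `k` and `k + 1` of that prefix. -/
noncomputable def block {A : Type*} (y : ℕ → A) (n k : ℕ) : List A :=
  factorAt y (cut y n k) (cut y n (k + 1) - cut y n k)

/-- The derived sequence of `y` with respect to its prefix of length `n`: the sequence of the return
words to that prefix, each being represented by the index at which it appears first. -/
noncomputable def derived {A : Type*} (y : ℕ → A) (n k : ℕ) : ℕ :=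
  sInf {j | block y n j = block y n k}

section

variable {A : Type*} {y : ℕ → A}

theorem Recurrent.infinite (hy : Recurrent y) (n : ℕ) :
    (Set.ofPred fun i => Agree y i 0 n).Infinite := by
  rw [Set.infinite_iff_exists_gt]
  intro N
  obtain ⟨i, hi, h⟩ := hy n (N + 1)
  exact ⟨i, h, hi⟩

theorem Recurrent.cut_strictMono (hy : Recurrent y) (n : ℕ) : StrictMono (cut y n) :=
  Nat.nth_strictMono (hy.infinite n)

theorem Recurrent.cut_lt (hy : Recurrent y) (n k : ℕ) : cut y n k < cut y n (k + 1) :=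
  hy.cut_strictMono n k.lt_succ_self

theorem Recurrent.cut_le (hy : Recurrent y) (n : ℕ) {i j : ℕ} (h : i ≤ j) :
    cut y n i ≤ cut y n j :=
  (hy.cut_strictMono n).monotone h

theorem cut_zero (y : ℕ → A) (n : ℕ) : cut y n 0 = 0 :=
  Nat.nth_zero_of_zero fun _ _ => rfl

theorem Recurrent.agree_cut (hy : Recurrent y) (n k : ℕ) : Agree y (cut y n k) 0 n :=
  Nat.nth_mem_of_infinite (hy.infinite n) k

theorem exists_cut_eq {n q : ℕ} (h : Agree y q 0 n) : ∃ j, cut y n j = q := by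
  obtain ⟨j, -, hj⟩ := Nat.exists_lt_card_nth_eq (p := fun i => Agree y i 0 n) h
  exact ⟨j, hj⟩

theorem Recurrent.not_agree (hy : Recurrent y) {n k e : ℕ} (h1 : cut y n k < e)
    (h2 : e < cut y n (k + 1)) : ¬ Agree y e 0 n := by
  intro h
  obtain ⟨j, rfl⟩ := exists_cut_eq h
  rw [(hy.cut_strictMono n).lt_iff_lt] at h1 h2
  omega

theorem Recurrent.cut_succ_eq (hy : Recurrent y) {n k e : ℕ} (h : Agree y e 0 n)
    (hlt : cut y n k < e) (hno : ∀ e', cut y n k < e' → e' < e → ¬ Agree y e' 0 n) :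
    cut y n (k + 1) = e := by
  rcases Nat.lt_trichotomy (cut y n (k + 1)) e with h1 | h1 | h1
  · exact absurd (hy.agree_cut n (k + 1)) (hno _ (hy.cut_lt n k) h1)
  · exact h1
  · exact absurd h (hy.not_agree hlt h1)

theorem Recurrent.block_eq_iff (hy : Recurrent y) {n i j : ℕ} :
    block y n i = block y n j ↔ cut y n (i + 1) + cut y n j = cut y n (j + 1) + cut y n i ∧
      Agree y (cut y n i) (cut y n j) (cut y n (i + 1) - cut y n i) := by
  have hi := hy.cut_lt n i
  have hj := hy.cut_lt n j
  constructor
  · intro h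
    have hl : cut y n (i + 1) - cut y n i = cut y n (j + 1) - cut y n j := by
      simpa [block] using congrArg List.length h
    rw [block, block, ← hl] at h
    exact ⟨by omega, factorAt_eq_iff.1 h⟩
  · rintro ⟨h1, h2⟩
    rw [block, block, show cut y n (j + 1) - cut y n j = cut y n (i + 1) - cut y n i by omega]
    exact factorAt_eq_iff.2 h2

theorem block_derived (y : ℕ → A) (n k : ℕ) : block y n (derived y n k) = block y n k :=
  Nat.sInf_mem (s := {j | block y n j = block y n k}) ⟨k, rfl⟩

theorem derived_eq_iff {n i j : ℕ} : derived y n i = derived y n j ↔ block y n i = block y n j := by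
  constructor
  · intro h
    rw [← block_derived y n i, h, block_derived]
  · intro h
    rw [derived, derived, h]

theorem derived_derived (y : ℕ → A) (n k : ℕ) : derived y n (derived y n k) = derived y n k :=
  derived_eq_iff.2 (block_derived y n k)

theorem derived_le {n j k : ℕ} (h : derived y n j = derived y n k) : derived y n k ≤ j :=
  Nat.sInf_le (derived_eq_iff.1 h)

/-- A factor of the derived sequence determines the factor of `y` that it codes, with the
occurrence of the prefix that follows. -/
theorem Recurrent.agree_of_derived (hy : Recurrent y) {n i j : ℕ} :
    ∀ {m : ℕ}, Agree (derived y n) i j m →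
      cut y n (i + m) + cut y n j = cut y n (j + m) + cut y n i ∧
        Agree y (cut y n i) (cut y n j) (cut y n (i + m) - cut y n i + n) := by
  intro m
  induction m with
  | zero =>
    intro _
    refine ⟨by rw [add_zero, add_zero, add_comm], fun t ht => ?_⟩
    rw [hy.agree_cut n i t (by simpa using ht), hy.agree_cut n j t (by simpa using ht)]
  | succ m ih =>
    intro h
    obtain ⟨h1, h2⟩ := ih (h.mono m.le_succ)
    obtain ⟨h3, h4⟩ := hy.block_eq_iff.1 (derived_eq_iff.1 (h m m.lt_succ_self))
    rw [add_assoc, add_assoc] at h3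
    rw [add_assoc] at h4
    have hi := hy.cut_le n (Nat.le_add_right i m)
    have hi' := hy.cut_lt n (i + m)
    have hj' := hy.cut_lt n (j + m)
    rw [add_assoc] at hi' hj'
    refine ⟨by omega, fun t ht => ?_⟩
    rcases Nat.lt_or_ge t (cut y n (i + m) - cut y n i + n) with h5 | h5
    · exact h2 t h5
    · rcases Nat.lt_or_ge (cut y n i + t) (cut y n (i + (m + 1))) with h6 | h6
      · exact h4.eq (by omega) (by omega) (by omega)
      · have h7 := hy.agree_cut n (i + (m + 1)) (cut y n i + t - cut y n (i + (m + 1))) (by omega)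
        have h8 := hy.agree_cut n (j + (m + 1)) (cut y n i + t - cut y n (i + (m + 1))) (by omega)
        rw [← h8] at h7
        convert h7 using 2 <;> omega

/-- Conversely, a second occurrence of the factor of `y` that is coded by a factor of the derived
sequence starts at an occurrence of the prefix, and it is coded in the same way. -/
theorem Recurrent.derived_of_agree (hy : Recurrent y) {n i m q : ℕ}
    (h : Agree y q (cut y n i) (cut y n (i + m) - cut y n i + n)) :
    ∃ j, q = cut y n j ∧ (∀ k ≤ m, cut y n (j + k) + cut y n i = cut y n (i + k) + cut y n j) ∧
      Agree (derived y n) j i m := by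
  have hocc : ∀ e, cut y n i ≤ e → e ≤ cut y n (i + m) →
      (Agree y (q + (e - cut y n i)) 0 n ↔ Agree y e 0 n) := by
    intro e h1 h2
    refine forall₂_congr fun t ht => ?_
    rw [show y (q + (e - cut y n i) + t) = y (e + t) from
      h.eq (by omega) (by omega) (by omega)]
  obtain ⟨j, hj⟩ := exists_cut_eq ((hocc (cut y n i) le_rfl (hy.cut_le n (by omega))).2
    (hy.agree_cut n i))
  obtain rfl : q = cut y n j := by omega
  have hcut : ∀ k ≤ m, cut y n (j + k) + cut y n i = cut y n (i + k) + cut y n j := by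
    intro k
    induction k with
    | zero => intro _; rw [add_zero, add_zero, add_comm]
    | succ k ih =>
      intro hk
      have ih := ih (by omega)
      have h1 := hy.cut_le n (Nat.le_add_right i k)
      have h2 := hy.cut_lt n (i + k)
      have h3 : cut y n (i + k + 1) ≤ cut y n (i + m) := hy.cut_le n (by omega)
      have h4 : cut y n (j + k + 1) = cut y n j + (cut y n (i + k + 1) - cut y n i) := by
        refine hy.cut_succ_eq ((hocc _ (by omega) h3).2 (hy.agree_cut n _)) (by omega) ?_
        intro e he1 he2 hag
        have h5 := hocc (e + cut y n i - cut y n j) (by omega) (by omega)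
        rw [show cut y n j + (e + cut y n i - cut y n j - cut y n i) = e by omega] at h5
        exact hy.not_agree (n := n) (k := i + k) (by omega) (by omega) (h5.1 hag)
      rw [← add_assoc, ← add_assoc]
      omega
  refine ⟨j, rfl, hcut, fun t ht => derived_eq_iff.2 (hy.block_eq_iff.2 ?_)⟩
  have h1 := hcut t (by omega)
  have h2 := hcut (t + 1) (by omega)
  have h3 := hy.cut_le n (Nat.le_add_right j t)
  have h5 := hy.cut_lt n (j + t)
  have h4 : cut y n (i + t + 1) ≤ cut y n (i + m) := hy.cut_le n (by omega)
  rw [← add_assoc, ← add_assoc] at h2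
  exact ⟨by omega, fun s hs => h.eq (by omega) (by omega) (by omega)⟩

/-- The complete returns to a palindromic prefix are palindromes. -/
theorem Recurrent.palAt_block (hy : Recurrent y) (hpr : PalReturns y) {n : ℕ}
    (hn : PalAt y 0 n) (k : ℕ) : PalAt y (cut y n k) (cut y n (k + 1) - cut y n k + n) := by
  have hlt := hy.cut_lt n k
  have h0 := hy.agree_cut n k
  refine hpr _ _ _ (by omega) (fun a b hab => ?_) (fun t ht => ?_) fun e he1 he2 hag => ?_
  · rw [h0 a (by omega), h0 b (by omega), hn a b hab]
  · rw [h0 t ht, ← hy.agree_cut n (k + 1) t ht]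
    congr 1
    omega
  · exact hy.not_agree (n := n) (k := k) (e := cut y n k + e) (by omega) (by omega) fun t ht => by
      rw [hag t ht, h0 t ht]

/-- Palindromes of `y` are coded by palindromes: the mirror symmetry maps occurrences of the prefix
to occurrences, and complete returns to complete returns, which are palindromes themselves. -/
theorem Recurrent.palAt_derived (hy : Recurrent y) (hpr : PalReturns y) {n : ℕ}
    (hn : PalAt y 0 n) {i m : ℕ}
    (h : PalAt y (cut y n i) (cut y n (i + m) - cut y n i + n)) : PalAt (derived y n) i m := by
  have hle := hy.cut_le n (Nat.le_add_right i m)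
  have hocc : ∀ e e', cut y n i ≤ e → cut y n i ≤ e' → e + e' = cut y n i + cut y n (i + m) →
      Agree y e 0 n → Agree y e' 0 n := by
    intro e e' h1 h2 h3 h4 t ht
    calc y (e' + t) = y (e + (n - 1 - t)) := h.eq (by omega) (by omega) (by omega)
      _ = y (0 + (n - 1 - t)) := h4 _ (by omega)
      _ = y (0 + t) := hn _ _ (by omega)
  have hcut : ∀ a b, a + b = m → cut y n (i + a) + cut y n (i + b) =
      cut y n i + cut y n (i + m) := by
    intro a
    induction a with
    | zero => intro b hb; rw [add_zero, ← hb, zero_add]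
    | succ a ih =>
      intro b hb
      have h1 := ih (b + 1) (by omega)
      have h2 := hy.cut_lt n (i + b)
      have h3 := hy.cut_le n (Nat.le_add_right i b)
      have h4 : cut y n (i + b) ≤ cut y n (i + m) := hy.cut_le n (by omega)
      have h5 := hy.cut_le n (Nat.le_add_right i a)
      rw [← add_assoc] at h1
      have h6 : cut y n (i + a + 1) = cut y n i + cut y n (i + m) - cut y n (i + b) := by
        refine hy.cut_succ_eq (hocc _ _ h3 (by omega) (by omega) (hy.agree_cut n (i + b)))
          (by omega) fun e he1 he2 hag => ?_
        exact hy.not_agree (k := i + b) (e := cut y n i + cut y n (i + m) - e) (by omega)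
          (by omega) (hocc _ _ (by omega) (by omega) (by omega) hag)
      rw [← add_assoc]
      omega
  intro a b hab
  have h1 := hcut a (b + 1) (by omega)
  have h2 := hcut (a + 1) b (by omega)
  have h3 := hy.cut_lt n (i + a)
  have h4 := hy.cut_lt n (i + b)
  have h5 := hy.cut_le n (Nat.le_add_right i a)
  have h6 := hy.cut_le n (Nat.le_add_right i b)
  rw [← add_assoc] at h1 h2
  refine derived_eq_iff.2 (hy.block_eq_iff.2 ⟨by omega, fun t ht => ?_⟩)
  calc y (cut y n (i + a) + t) = y (cut y n (i + b + 1) + n - 1 - t) :=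
        h.eq (by omega) (by omega) (by omega)
    _ = y (cut y n (i + b) + t) :=
        (hy.palAt_block hpr hn (i + b)).eq (by omega) (by omega) (by omega)

theorem exists_complete_return (y : ℕ → A) (n : ℕ) {i m p : ℕ} (h1 : cut y n i ≤ p)
    (h2 : p < cut y n (i + m) + n) (hm : 0 < m) :
    ∃ a < m, cut y n (i + a) ≤ p ∧ p < cut y n (i + a + 1) + n := by
  induction m with
  | zero => omega
  | succ m ih =>
    rcases Nat.lt_or_ge p (cut y n (i + m)) with h | h
    · have hm0 : 0 < m := by
        rcases Nat.eq_zero_or_pos m with rfl | h0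
        · simp only [add_zero] at h; omega
        · exact h0
      obtain ⟨a, ha, h3⟩ := ih (by omega) hm0
      exact ⟨a, by omega, h3⟩
    · exact ⟨m, by omega, h, h2⟩

/-- Palindromes of the derived sequence code palindromes of `y`. -/
theorem Recurrent.palAt_of_derived (hy : Recurrent y) (hpr : PalReturns y) {n : ℕ}
    (hn : PalAt y 0 n) {i m : ℕ} (h : PalAt (derived y n) i m) :
    PalAt y (cut y n i) (cut y n (i + m) - cut y n i + n) := by
  rcases Nat.eq_zero_or_pos m with rfl | hm
  · intro a b hab
    rw [hy.agree_cut n i a (by simp at hab; omega), hy.agree_cut n i b (by simp at hab; omega)]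
    exact hn a b (by simpa using hab)
  have hle := hy.cut_le n (Nat.le_add_right i m)
  have hblock : ∀ a b, a + b + 1 = m →
      cut y n (i + a + 1) + cut y n (i + b) = cut y n (i + b + 1) + cut y n (i + a) ∧
      Agree y (cut y n (i + a)) (cut y n (i + b)) (cut y n (i + a + 1) - cut y n (i + a) + n) :=
    fun a b hab => hy.agree_of_derived (m := 1) fun t ht => by
      obtain rfl : t = 0 := by omega
      exact h a b hab
  have hcut : ∀ a b, a + b = m → cut y n (i + a) + cut y n (i + b) =
      cut y n i + cut y n (i + m) := by
    intro a
    induction a with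
    | zero => intro b hb; rw [add_zero, ← hb, zero_add]
    | succ a ih =>
      intro b hb
      have h1 := ih (b + 1) (by omega)
      have h2 := (hblock a b (by omega)).1
      rw [← add_assoc] at h1 ⊢
      omega
  intro u v huv
  obtain ⟨a, ha, h1, h2⟩ := exists_complete_return y n (i := i) (m := m) (p := cut y n i + u) (by omega)
    (by omega) hm
  obtain ⟨b, hb⟩ : ∃ b, a + b + 1 = m := ⟨m - a - 1, by omega⟩
  have h3 := hcut a (b + 1) (by omega)
  obtain ⟨h4, h5⟩ := hblock a b hb
  have h6 := hy.cut_lt n (i + a)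
  rw [← add_assoc] at h3
  calc y (cut y n i + u) = y (cut y n (i + a) + cut y n (i + a + 1) + n - 1 - (cut y n i + u)) :=
        (hy.palAt_block hpr hn (i + a)).eq (by omega) (by omega) (by omega)
    _ = y (cut y n i + v) := h5.eq (by omega) (by omega) (by omega)

/-- Richness passes to derived sequences with respect to palindromic prefixes. -/
theorem Recurrent.palReturns_derived (hy : Recurrent y) (hpr : PalReturns y) {n : ℕ}
    (hn : PalAt y 0 n) : PalReturns (derived y n) := by
  intro i d m hd hpal hag hno
  have h1 := hy.cut_strictMono n (show i < i + d by omega)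
  have h2 := hy.cut_le n (Nat.le_add_right i m)
  obtain ⟨h3, h4⟩ := hy.agree_of_derived hag.symm
  have h5 := hpr (cut y n i) (cut y n (i + d) - cut y n i) (cut y n (i + m) - cut y n i + n)
    (by omega) (hy.palAt_of_derived hpr hn hpal)
    (by rw [show cut y n i + (cut y n (i + d) - cut y n i) = cut y n (i + d) by omega]
        exact h4.symm) ?_
  · apply hy.palAt_derived hpr hn
    convert h5 using 1
    rw [← add_assoc]
    omega
  · intro e he1 he2 hag'
    obtain ⟨j, hj, -, hj'⟩ := hy.derived_of_agree hag'
    have h6 : i < j := (hy.cut_strictMono n).lt_iff_lt.1 (by omega)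
    have h7 : j < i + d := (hy.cut_strictMono n).lt_iff_lt.1 (by omega)
    refine hno (j - i) (by omega) (by omega) ?_
    rwa [show i + (j - i) = j by omega]

/-- The complete return to a palindromic prefix is again a palindromic prefix. -/
theorem Recurrent.exists_palindromic_prefix (hy : Recurrent y) (hpr : PalReturns y) (N : ℕ) :
    ∃ n, N ≤ n ∧ PalAt y 0 n := by
  induction N with
  | zero => exact ⟨0, le_rfl, fun a b hab => by omega⟩
  | succ N ih =>
    obtain ⟨n, hN, hn⟩ := ih
    have h1 := hy.palAt_block hpr hn 0
    have h2 := hy.cut_lt n 0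
    rw [cut_zero] at h1 h2
    exact ⟨_, by omega, h1⟩

end

/-! ### Linear recurrence -/

/-- Every factor of length `n` of `y` occurs in every factor of length `K * n`. -/
def LinearlyRecurrent {A : Type*} (y : ℕ → A) (K : ℕ) : Prop :=
  ∀ i n j, 0 < n → ∃ k, j ≤ k ∧ k + n ≤ j + K * n ∧ Agree y k i n

/-- `y` is not purely periodic. -/
def Aperiodic {A : Type*} (y : ℕ → A) : Prop :=
  ∀ p, 0 < p → ¬ ∀ k, y (k + p) = y k

section

variable {A : Type*} {y : ℕ → A} {K : ℕ}

theorem LinearlyRecurrent.recurrent (h : LinearlyRecurrent y K) : Recurrent y := by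
  intro n N
  obtain ⟨k, h1, -, h2⟩ := h 0 (n + 1) N n.succ_pos
  exact ⟨k, h1, h2.mono n.le_succ⟩

theorem LinearlyRecurrent.cut_succ_le (h : LinearlyRecurrent y K) {n : ℕ} (hn : 0 < n) (k : ℕ) :
    cut y n (k + 1) ≤ cut y n k + K * n := by
  obtain ⟨q, h1, h2, h3⟩ := h 0 n (cut y n k + 1) hn
  obtain ⟨j, rfl⟩ := exists_cut_eq h3
  have h4 : k < j := (h.recurrent.cut_strictMono n).lt_iff_lt.1 (by omega)
  have h5 := h.recurrent.cut_le n (show k + 1 ≤ j from h4)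
  omega

/-- A return word `d` letters long gives its prefix the period `d`. If the prefix had length at
least `K * (d + 1)`, then all factors of length `d + 1` would occur in it, and `d` would be a period
of `y`. -/
theorem LinearlyRecurrent.lt_return (h : LinearlyRecurrent y K) (hap : Aperiodic y) (n k : ℕ) :
    n < K * (cut y n (k + 1) - cut y n k + 1) := by
  by_contra! hle
  have hlt := h.recurrent.cut_lt n k
  refine hap (cut y n (k + 1) - cut y n k) (by omega) fun m => ?_
  obtain ⟨q, h1, h2, h3⟩ := h m (cut y n (k + 1) - cut y n k + 1) (cut y n k) (by omega)
  have h4 := h.recurrent.agree_cut n k (q - cut y n k) (by omega)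
  have h5 := h.recurrent.agree_cut n (k + 1) (q - cut y n k) (by omega)
  have h6 : y q = y (m + 0) := h3 0 (by omega)
  have h7 := h3 (cut y n (k + 1) - cut y n k) (by omega)
  rw [← h7]
  rw [add_zero] at h6
  rw [← h6, show q = cut y n k + (q - cut y n k) by omega, h4, ← h5]
  congr 1
  omega

theorem LinearlyRecurrent.mul_le_cut (h : LinearlyRecurrent y K) (hap : Aperiodic y) (n k q : ℕ) :
    q * n + 2 * K * cut y n k ≤ 2 * K * cut y n (k + q) := by
  induction q with
  | zero => simp
  | succ q ih =>
    have h1 := h.lt_return hap n (k + q)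
    have h2 := h.recurrent.cut_lt n (k + q)
    obtain ⟨d, hd⟩ := Nat.exists_eq_add_of_lt h2
    rw [← add_assoc, hd]
    rw [hd, show cut y n (k + q) + d + 1 - cut y n (k + q) + 1 = d + 2 by omega] at h1
    nlinarith [Nat.zero_le (K * d)]

/-- Every return word to a prefix of length `n` appears in every factor of length
`K * ((K + 1) * n)`. -/
theorem LinearlyRecurrent.exists_derived_eq (h : LinearlyRecurrent y K) {n : ℕ} (hn : 0 < n)
    (k p : ℕ) : ∃ j, p ≤ cut y n j ∧ cut y n (j + 1) ≤ p + K * ((K + 1) * n) ∧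
      derived y n j = derived y n k := by
  have h1 := h.cut_succ_le hn k
  have hlt := h.recurrent.cut_lt n k
  have hN : cut y n (k + 1) - cut y n k + n ≤ (K + 1) * n := by
    rw [add_mul, one_mul]
    omega
  obtain ⟨q, h2, h3, h4⟩ := h (cut y n k) (cut y n (k + 1) - cut y n k + n) p (by omega)
  obtain ⟨j, rfl, h5, h6⟩ := h.recurrent.derived_of_agree (m := 1) h4
  have h7 := h5 1 le_rfl
  have h8 := Nat.mul_le_mul_left K hN
  exact ⟨j, h2, by omega, h6 0 one_pos⟩

theorem LinearlyRecurrent.derived_le (h : LinearlyRecurrent y K) (hap : Aperiodic y) {n : ℕ}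
    (hn : 0 < n) (k : ℕ) : derived y n k ≤ 2 * K * (K * (K + 1)) := by
  obtain ⟨j, -, h1, h2⟩ := h.exists_derived_eq hn k 0
  refine (RichWords.derived_le h2).trans ?_
  have h3 := h.mul_le_cut hap n 0 j
  have h4 := h.recurrent.cut_lt n j
  rw [cut_zero, zero_add] at h3
  refine Nat.le_of_mul_le_mul_right (c := n) ?_ hn
  have h5 : cut y n j ≤ K * ((K + 1) * n) := by omega
  have h6 := Nat.mul_le_mul_left (2 * K) h5
  nlinarith

end

/-! ### Parsings and the finiteness of the set of derived sequences -/

theorem isImage_of_pos {X B : Type*} {f : X → List B} {x : ℕ → X} {y : ℕ → B} {pos : ℕ → ℕ}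
    (h0 : pos 0 = 0) (hmono : Monotone pos) (hunb : ∀ N, ∃ i, N ≤ pos i)
    (h : ∀ i, f (x i) = factorAt y (pos i) (pos (i + 1) - pos i)) : IsImage f x y := by
  have key : ∀ n, (factorAt x 0 n).flatMap f = factorAt y 0 (pos n) := by
    intro n
    induction n with
    | zero => simp [factorAt, h0]
    | succ n ih =>
      have h1 : pos n ≤ pos (n + 1) := hmono n.le_succ
      have h2 := factorAt_append y 0 (pos n) (pos (n + 1) - pos n)
      rw [zero_add, show pos n + (pos (n + 1) - pos n) = pos (n + 1) by omega] at h2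
      rw [factorAt_succ, List.flatMap_append, ih, zero_add, List.flatMap_singleton, h, h2]
  refine ⟨fun n => by rw [key]; simp, fun N => ?_⟩
  obtain ⟨i, hi⟩ := hunb N
  exact ⟨i, by rw [key]; simpa using hi⟩

/-- The positions `pos` cut `y` into nonempty words, and the letter `x i` determines the word between
`pos i` and `pos (i + 1)`. -/
structure Parsing {X A : Type*} (x : ℕ → X) (y : ℕ → A) (pos : ℕ → ℕ) : Prop where
  zero : pos 0 = 0
  lt : ∀ i, pos i < pos (i + 1)
  agree : ∀ i j, x i = x j → pos (i + 1) + pos j = pos (j + 1) + pos i ∧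
    Agree y (pos i) (pos j) (pos (i + 1) - pos i)

theorem exists_between {pos : ℕ → ℕ} (h0 : pos 0 = 0) (h : StrictMono pos) (p : ℕ) :
    ∃ k, pos k ≤ p ∧ p < pos (k + 1) := by
  induction p with
  | zero => exact ⟨0, h0.le, by have := h (Nat.lt_add_one 0); omega⟩
  | succ p ih =>
    obtain ⟨k, h1, h2⟩ := ih
    rcases Nat.lt_or_ge (p + 1) (pos (k + 1)) with h3 | h3
    · exact ⟨k, by omega, h3⟩
    · exact ⟨k + 1, h3, by have := h (Nat.lt_add_one (k + 1)); omega⟩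

/-- At every scale `n`, the sequence `x` parses `y` into words of lengths between `n` and
`K * n`. -/
def ScalableParsing {X A : Type*} (x : ℕ → X) (y : ℕ → A) (K : ℕ) : Prop :=
  ∀ n, 0 < n → ∃ pos, Parsing x y pos ∧ ∀ i, pos i + n ≤ pos (i + 1) ∧ pos (i + 1) ≤ pos i + K * n

/-- Every pair of consecutive letters of `x` occurs in every window of length `G`. -/
def PairRecurrent {X : Type*} (x : ℕ → X) (G : ℕ) : Prop :=
  ∀ i k, ∃ j, k ≤ j ∧ j < k + G ∧ x j = x i ∧ x (j + 1) = x (i + 1)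

section

variable {X A : Type*} {x : ℕ → X} {y : ℕ → A} {pos : ℕ → ℕ} {K L G : ℕ}

theorem Parsing.strictMono (h : Parsing x y pos) : StrictMono pos :=
  strictMono_nat_of_lt_succ h.lt

theorem Parsing.agree_pair (h : Parsing x y pos) {i j : ℕ} (h0 : x i = x j)
    (h1 : x (i + 1) = x (j + 1)) :
    pos (i + 2) + pos j = pos (j + 2) + pos i ∧ Agree y (pos i) (pos j) (pos (i + 2) - pos i) := by
  obtain ⟨h2, h3⟩ := h.agree i j h0
  obtain ⟨h4, h5⟩ := h.agree (i + 1) (j + 1) h1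
  have h6 := h.lt i
  have h7 := h.lt (i + 1)
  have h8 := h.lt j
  refine ⟨by simp only [add_assoc, Nat.reduceAdd] at *; omega, fun t ht => ?_⟩
  rcases Nat.lt_or_ge (pos i + t) (pos (i + 1)) with h9 | h9
  · exact h3 t (by omega)
  · exact h5.eq (by omega) (by simp only [add_assoc, Nat.reduceAdd] at *; omega) (by omega)

/-- A factor of length `n` is covered by two consecutive words of a parsing at scale `n`. -/
theorem ScalableParsing.linearlyRecurrent (h : ScalableParsing x y L) (hx : PairRecurrent x G) :
    LinearlyRecurrent y ((G + 2) * L) := by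
  intro i n j hn
  obtain ⟨pos, hp, hpos⟩ := h n hn
  obtain ⟨k, hk1, hk2⟩ := exists_between hp.zero hp.strictMono i
  obtain ⟨l, hl1, hl2⟩ := exists_between hp.zero hp.strictMono j
  obtain ⟨m, hm1, hm2, hm3, hm4⟩ := hx k (l + 1)
  obtain ⟨h1, h2⟩ := hp.agree_pair hm3 hm4
  have h3 : ∀ q, pos (l + q) ≤ pos l + q * (L * n) := by
    intro q
    induction q with
    | zero => simp
    | succ q ih =>
      have := (hpos (l + q)).2
      rw [← add_assoc, add_mul, one_mul]
      omega
  have h4 := hp.strictMono.monotone (show m + 2 ≤ l + (G + 2) by omega)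
  have h5 := hp.strictMono.monotone hm1
  have h6 := h3 (G + 2)
  have h7 := (hpos (k + 1)).1
  rw [mul_assoc]
  simp only [add_assoc, Nat.reduceAdd] at *
  exact ⟨pos m + (i - pos k), by omega, by omega, fun t ht => h2.eq (by omega) (by omega) (by omega)⟩

/-- In a parsing at scale `(K + 1) * n`, two consecutive words cover the complete returns to the
prefix of length `n` that start in the first of them. So the part of the derived sequence that is
read off the first word depends only on two letters of `x`, and its length and its entries are
bounded independently of `n`. -/
theorem LinearlyRecurrent.exists_isImage_derived (hy : LinearlyRecurrent y K) (hap : Aperiodic y)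
    (h : ScalableParsing x y L) {n : ℕ} (hn : 0 < n) :
    ∃ c : X × X → List ℕ, (∀ a, (c a).length ≤ 2 * K * (L * (K + 1)) + 1 ∧
      ∀ v ∈ c a, v < 2 * K * (K * (K + 1)) + 1) ∧
      IsImage c (fun i => (x i, x (i + 1))) (derived y n) := by
  classical
  have hr := hy.recurrent
  obtain ⟨pos, hp, hpos⟩ := h ((K + 1) * n) (by positivity)
  -- `num p` is the index of the first occurrence at or after `p`
  let num : ℕ → ℕ := fun p => Nat.count (fun i => Agree y i 0 n) p
  let code : ℕ → List ℕ := fun i =>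
    factorAt (derived y n) (num (pos i)) (num (pos (i + 1)) - num (pos i))
  have hlt : ∀ k p, cut y n k < p ↔ k < num p := fun k p => by
    rw [← not_le, ← not_le, not_iff_not]
    exact (Nat.count_le_iff_le_nth (hr.infinite n)).symm
  have hmono : Monotone num := Nat.count_monotone _
  -- the code of a word depends on two letters only
  have hcode : ∀ i j, x i = x j → x (i + 1) = x (j + 1) → code i = code j := by
    intro i j h0 h1
    obtain ⟨-, h3⟩ := hp.agree_pair h0 h1
    have h2 := (hp.agree i j h0).1
    have h4 := hp.lt i
    have h5 := (hpos (i + 1)).1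
    simp only [add_assoc, Nat.reduceAdd, add_mul, one_mul] at h5
    have hshift : ∀ t, t ≤ pos (i + 1) - pos i →
        num (pos i + t) + num (pos j) = num (pos j + t) + num (pos i) := by
      intro t
      induction t with
      | zero => intro _; rw [add_zero, add_zero, add_comm]
      | succ t ih =>
        intro ht
        have ih := ih (by omega)
        have hiff : Agree y (pos i + t) 0 n ↔ Agree y (pos j + t) 0 n :=
          forall₂_congr fun s hs => by
            rw [show y (pos i + t + s) = y (pos j + t + s) from
              h3.eq (by omega) (by omega) (by omega)]
        simp only [num, ← add_assoc, Nat.count_succ, hiff] at ih ⊢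
        omega
    have h6 := hshift _ le_rfl
    have h7 := hp.lt j
    rw [show pos i + (pos (i + 1) - pos i) = pos (i + 1) by omega,
      show pos j + (pos (i + 1) - pos i) = pos (j + 1) by omega] at h6
    have h8 := hmono h4.le
    simp only [code]
    rw [show num (pos (j + 1)) - num (pos j) = num (pos (i + 1)) - num (pos i) by omega]
    refine factorAt_eq_iff.2 fun s hs => ?_
    have h9 := (hlt (num (pos i) + s) (pos (i + 1))).2 (by omega)
    have h10 := (hlt (num (pos i) + s) (pos i)).not.2 (by omega)
    have h11 : num (cut y n (num (pos i) + s)) = num (pos i) + s :=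
      Nat.count_nth_of_infinite (hr.infinite n) _
    have h12 := hshift (cut y n (num (pos i) + s) - pos i) (by omega)
    rw [show pos i + (cut y n (num (pos i) + s) - pos i) = cut y n (num (pos i) + s) by omega] at h12
    have h13 := hy.cut_succ_le hn (num (pos i) + s)
    obtain ⟨l, hl1, -, hl2⟩ := hr.derived_of_agree (n := n) (i := num (pos i) + s) (m := 1)
      (q := pos j + (cut y n (num (pos i) + s) - pos i))
      (fun t ht => (h3.eq (by omega) (by omega) (by omega)).symm)
    have h14 : num (cut y n l) = l := Nat.count_nth_of_infinite (hr.infinite n) _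
    obtain rfl : l = num (pos j) + s := by
      rw [← h14, ← hl1]
      omega
    exact (hl2 0 one_pos).symm
  refine ⟨fun a => if ha : ∃ i, x i = a.1 ∧ x (i + 1) = a.2 then code ha.choose else [], ?_, ?_⟩
  · intro a
    dsimp only
    split_ifs with ha
    · generalize ha.choose = i
      constructor
      · simp only [code, length_factorAt]
        by_contra! hgt
        have h1 := (hlt (num (pos i) + (num (pos (i + 1)) - num (pos i) - 1))
          (pos (i + 1))).2 (by omega)
        have h2 := (hlt (num (pos i)) (pos i)).not.2 (by omega)
        have h3 := hy.mul_le_cut hap n (num (pos i)) (num (pos (i + 1)) - num (pos i) - 1)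
        have h4 := (hpos i).2
        have h5 : (2 * K * (L * (K + 1)) + 1) * n ≤ (num (pos (i + 1)) - num (pos i) - 1) * n :=
          Nat.mul_le_mul_right n (by omega)
        have h6 : cut y n (num (pos i) + (num (pos (i + 1)) - num (pos i) - 1)) ≤
            cut y n (num (pos i)) + L * ((K + 1) * n) := by omega
        have h7 := Nat.mul_le_mul_left (2 * K) h6
        nlinarith
      · intro v hv
        obtain ⟨t, -, rfl⟩ := mem_factorAt.1 hv
        exact Nat.lt_succ_of_le (hy.derived_le hap hn _)
    · simp
  · refine isImage_of_pos (pos := fun i => num (pos i)) (by simp [num, hp.zero])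
      (hmono.comp hp.strictMono.monotone) (fun N => ?_) fun i => ?_
    · refine ⟨cut y n N + 1, ?_⟩
      have h1 := hp.strictMono.le_apply (x := cut y n N + 1)
      exact ((hlt N _).1 h1).le
    · have ha : ∃ k, x k = x i ∧ x (k + 1) = x (i + 1) := ⟨i, rfl, rfl⟩
      dsimp only
      rw [dif_pos ha]
      exact hcode _ _ ha.choose_spec.1 ha.choose_spec.2

/-- Only finitely many sequences are derived sequences of `y`. -/
theorem LinearlyRecurrent.finite_derived [Finite X] (hy : LinearlyRecurrent y K)
    (hap : Aperiodic y) (h : ScalableParsing x y L) :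
    {d : ℕ → ℕ | ∃ n, 0 < n ∧ derived y n = d}.Finite := by
  let S : Set (List ℕ) := {l | l.length ≤ 2 * K * (L * (K + 1)) + 1 ∧
      ∀ v ∈ l, v < 2 * K * (K * (K + 1)) + 1}
  have hS : S.Finite := by
    refine ((List.finite_length_le (Fin (2 * K * (K * (K + 1)) + 1))
      (2 * K * (L * (K + 1)) + 1)).image (List.map Fin.val)).subset ?_
    rintro l ⟨h1, h2⟩
    lift l to List (Fin (2 * K * (K * (K + 1)) + 1)) using h2
    exact ⟨l, by simpa using h1, rfl⟩
  have hF : {c : X × X → List ℕ | ∀ a, c a ∈ S}.Finite := Set.Finite.pi' fun _ => hS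
  refine (hF.biUnion (t := fun c => {d | IsImage c (fun i => (x i, x (i + 1))) d})
    fun c _ => Set.Subsingleton.finite fun d hd e he => hd.unique he).subset ?_
  rintro d ⟨n, hn, rfl⟩
  obtain ⟨c, hc, hc'⟩ := hy.exists_isImage_derived hap h hn
  exact Set.mem_biUnion hc hc'

/-- By the pigeonhole principle, some palindromic prefix shares its derived sequence with arbitrarily
long palindromic prefixes. -/
theorem LinearlyRecurrent.exists_derived_eq_derived [Finite X] (hy : LinearlyRecurrent y K)
    (hap : Aperiodic y) (h : ScalableParsing x y L) (hpr : PalReturns y) :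
    ∃ n, 0 < n ∧ PalAt y 0 n ∧ ∀ N, ∃ m, N ≤ m ∧ PalAt y 0 m ∧ derived y m = derived y n := by
  by_contra! hcon
  have hfin : {n | 0 < n ∧ PalAt y 0 n}.Finite := by
    refine ((hy.finite_derived hap h).biUnion
      (t := fun d => {n | (0 < n ∧ PalAt y 0 n) ∧ derived y n = d}) fun d _ => ?_).subset
      fun n hn => Set.mem_biUnion (show derived y n ∈ _ from ⟨n, hn.1, rfl⟩) ⟨hn, rfl⟩
    by_cases hd : ∃ n, (0 < n ∧ PalAt y 0 n) ∧ derived y n = d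
    · obtain ⟨n, ⟨hn, hn'⟩, rfl⟩ := hd
      obtain ⟨N, hN⟩ := hcon n hn hn'
      refine (Set.finite_lt_nat N).subset fun m hm => ?_
      by_contra hge
      exact hN m (not_lt.1 hge) hm.1.2 hm.2
    · convert Set.finite_empty
      ext n
      simp only [Set.mem_ofPred_eq, Set.mem_empty_iff_false, iff_false]
      exact fun hn => hd ⟨n, hn⟩
  obtain ⟨N, hN⟩ := hfin.bddAbove
  obtain ⟨n, hn, hn'⟩ := hy.recurrent.exists_palindromic_prefix hpr (N + 1)
  have := hN (show n ∈ {n | 0 < n ∧ PalAt y 0 n} from ⟨by omega, hn'⟩)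
  omega

end

/-! ### Parsings of primitive morphic words -/

section

variable {X B D : Type*}

theorem IsImage.comp {f : X → List B} {g : B → List D} {x : ℕ → X} {y : ℕ → B} {z : ℕ → D}
    (hf : IsImage f x y) (hg : IsImage g y z) : IsImage (fun a => (f a).flatMap g) x z := by
  have key : ∀ n, (factorAt x 0 n).flatMap (fun a => (f a).flatMap g) =
      (factorAt y 0 ((factorAt x 0 n).flatMap f).length).flatMap g := fun n => by
    rw [← List.flatMap_assoc, hf.1 n, length_factorAt]
  refine ⟨fun n => by rw [key, ← hg.1], fun N => ?_⟩
  obtain ⟨m, hm⟩ := hg.2 N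
  obtain ⟨n, hn⟩ := hf.2 m
  refine ⟨n, hm.trans ?_⟩
  rw [key]
  obtain ⟨k, hk⟩ := Nat.exists_eq_add_of_le hn
  rw [hk, ← factorAt_append, List.flatMap_append, List.length_append]
  exact Nat.le_add_right _ _

theorem isImage_singleton (x : ℕ → X) : IsImage (fun a => [a]) x x :=
  ⟨fun n => by simp, fun N => ⟨N, by simp⟩⟩

theorem iterate_flatMap (τ : X → List X) (n : ℕ) (w : List X) :
    (fun w : List X => w.flatMap τ)^[n] w =
      w.flatMap fun a => (fun w : List X => w.flatMap τ)^[n] [a] := by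
  induction n generalizing w with
  | zero => simp
  | succ n ih =>
    simp only [Function.iterate_succ_apply, List.flatMap_singleton]
    rw [ih, List.flatMap_assoc]
    congr 1
    funext a
    exact (ih (τ a)).symm

theorem IsImage.iterate {τ : X → List X} {x : ℕ → X} (h : IsImage τ x x) (n : ℕ) :
    IsImage (fun a => (fun w : List X => w.flatMap τ)^[n] [a]) x x := by
  induction n with
  | zero => exact isImage_singleton x
  | succ n ih =>
    convert h.comp ih using 1
    funext a
    rw [Function.iterate_succ_apply, iterate_flatMap, List.flatMap_singleton]

/-- The position in `f(x)` at which the image of the letter number `k` of `x` starts. -/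
def imagePos (f : X → List B) (x : ℕ → X) (k : ℕ) : ℕ :=
  ((factorAt x 0 k).flatMap f).length

theorem imagePos_zero (f : X → List B) (x : ℕ → X) : imagePos f x 0 = 0 := by
  simp [imagePos, factorAt]

theorem imagePos_succ (f : X → List B) (x : ℕ → X) (k : ℕ) :
    imagePos f x (k + 1) = imagePos f x k + (f (x k)).length := by
  simp [imagePos, factorAt_succ]

theorem IsImage.apply_eq {f : X → List B} {x : ℕ → X} {y : ℕ → B} (h : IsImage f x y) (k : ℕ) :
    f (x k) = factorAt y (imagePos f x k) (f (x k)).length := by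
  have h1 := h.1 (k + 1)
  rw [← imagePos, imagePos_succ, factorAt_succ, List.flatMap_append, h.1 k, ← factorAt_append,
    zero_add, List.flatMap_singleton, zero_add] at h1
  exact (List.append_inj h1 (by simp [imagePos])).2

theorem IsImage.parsing {f : X → List B} {x : ℕ → X} {y : ℕ → B} (h : IsImage f x y)
    (hf : NonErasing f) : Parsing x y (imagePos f x) where
  zero := imagePos_zero f x
  lt i := by
    have := List.length_pos_iff.2 (hf (x i))
    rw [imagePos_succ]
    omega
  agree i j hij := by
    have h1 := h.apply_eq i
    have h2 := h.apply_eq j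
    rw [← hij, h1, length_factorAt] at h2
    rw [imagePos_succ, imagePos_succ, ← hij]
    exact ⟨by omega, fun t ht => factorAt_eq_iff.1 h2 t (by omega)⟩

/-- The morphism `f ∘ S ^ e`. -/
def level (S : X → List X) (f : X → List B) : ℕ → X → List B
  | 0 => f
  | e + 1 => fun a => (S a).flatMap (level S f e)

theorem IsImage.level {S : X → List X} {f : X → List B} {x : ℕ → X} {y : ℕ → B}
    (hS : IsImage S x x) (hf : IsImage f x y) (e : ℕ) : IsImage (level S f e) x y := by
  induction e with
  | zero => exact hf
  | succ e ih => exact hS.comp ih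

/-- The total length of the images of the letters under a morphism. -/
def totalLength [Fintype X] (f : X → List B) : ℕ :=
  ∑ a, (f a).length

theorem length_le_totalLength [Fintype X] (f : X → List B) (a : X) :
    (f a).length ≤ totalLength f :=
  Finset.single_le_sum (f := fun b => (f b).length) (fun _ _ => Nat.zero_le _) (Finset.mem_univ a)

theorem totalLength_pos [Fintype X] {f : X → List B} {x : ℕ → X} {y : ℕ → B}
    (h : IsImage f x y) : 0 < totalLength f := by
  rw [Nat.pos_iff_ne_zero]
  intro h0
  obtain ⟨n, hn⟩ := h.2 1
  have h1 : ∀ a, f a = [] := fun a => by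
    have := length_le_totalLength f a
    exact List.length_eq_zero_iff.1 (by omega)
  simp [h1] at hn

theorem totalLength_le_length_level [Fintype X] {S : X → List X} (hS : ∀ a b, b ∈ S a)
    (f : X → List B) (e : ℕ) (a : X) : totalLength (level S f e) ≤ (level S f (e + 1) a).length := by
  classical
  have huniv : (S a).toFinset = Finset.univ := by
    ext b
    simp [hS a b]
  rw [level, List.length_flatMap, Finset.sum_list_map_count, huniv, totalLength]
  refine Finset.sum_le_sum fun b _ => ?_
  rw [smul_eq_mul]
  exact Nat.le_mul_of_pos_left _ (List.count_pos_iff.2 (hS a b))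

theorem length_level_le [Fintype X] (S : X → List X) (f : X → List B) (e : ℕ) (a : X) :
    (level S f (e + 1) a).length ≤ totalLength S * totalLength (level S f e) := by
  rw [level, List.length_flatMap]
  refine (List.sum_le_card_nsmul _ (totalLength (level S f e)) fun n hn => ?_).trans ?_
  · obtain ⟨b, -, rfl⟩ := List.mem_map.1 hn
    exact length_le_totalLength _ b
  · rw [List.length_map, smul_eq_mul]
    exact Nat.mul_le_mul_right _ (length_le_totalLength S a)

theorem lt_totalLength_level [Fintype X] [Nontrivial X] {S : X → List X} (hS : ∀ a b, b ∈ S a)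
    {f : X → List B} (hf : 0 < totalLength f) (e : ℕ) : e < totalLength (level S f e) := by
  induction e with
  | zero => exact hf
  | succ e ih =>
    have h1 : Fintype.card X * totalLength (level S f e) ≤ totalLength (level S f (e + 1)) := by
      rw [totalLength, ← smul_eq_mul]
      exact Finset.card_nsmul_le_sum _ _ _ fun a _ => totalLength_le_length_level hS f e a
    have h2 := Nat.mul_le_mul_right (totalLength (level S f e))
      (Fintype.one_lt_card (α := X))
    omega

/-- The image of every letter under `f ∘ S ^ (e + 1)` is about as long as the images of all letters
under `f ∘ S ^ e` together; so for each `n` some `e` gives images of length about `n`. -/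
theorem IsImage.scalableParsing [Fintype X] [Nontrivial X] {S : X → List X}
    (hS : ∀ a b, b ∈ S a) {f : X → List B} {x : ℕ → X} {y : ℕ → B} (hx : IsImage S x x)
    (hf : IsImage f x y) :
    ScalableParsing x y (totalLength S * (totalLength f + Fintype.card X * totalLength S)) := by
  classical
  intro n hn
  have hex : ∃ e, n ≤ totalLength (RichWords.level S f e) :=
    ⟨n, (lt_totalLength_level hS (totalLength_pos hf) n).le⟩
  have hbound : totalLength (RichWords.level S f (Nat.find hex)) ≤
      (totalLength f + Fintype.card X * totalLength S) * n := by
    rcases he : Nat.find hex with _ | e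
    · calc totalLength f ≤ totalLength f * n := Nat.le_mul_of_pos_right _ hn
        _ ≤ _ := Nat.mul_le_mul_right n (Nat.le_add_right _ _)
    · have h1 := Nat.find_min hex (m := e) (by omega)
      calc totalLength (RichWords.level S f (e + 1))
          ≤ Fintype.card X • (totalLength S * totalLength (RichWords.level S f e)) :=
            Finset.sum_le_card_nsmul _ _ _ fun a _ => length_level_le S f e a
        _ ≤ Fintype.card X * totalLength S * n := by
            rw [smul_eq_mul, ← mul_assoc]
            exact Nat.mul_le_mul_left _ (by omega)
        _ ≤ _ := Nat.mul_le_mul_right n (Nat.le_add_left _ _)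
  have hspec := Nat.find_spec hex
  generalize Nat.find hex = e at hbound hspec
  -- the level after the first one of total length at least `n`
  have hlow := fun a => hspec.trans (totalLength_le_length_level hS f e a)
  refine ⟨imagePos (RichWords.level S f (e + 1)) x, (hx.level hf (e + 1)).parsing fun a => ?_,
    fun i => ?_⟩
  · exact List.ne_nil_of_length_pos (hn.trans_le (hlow a))
  · rw [imagePos_succ, mul_assoc]
    have h1 := length_level_le S f e (x i)
    have h2 := Nat.mul_le_mul_left (totalLength S) hbound
    have h3 := hlow (x i)
    omega

/-- All pairs of consecutive letters occur in some prefix `S ^ e (x 0)` of `x`, which is a factor of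
`S ^ (e + 1) (a)` for every letter `a`. -/
theorem IsImage.pairRecurrent [Fintype X] [Nontrivial X] {S : X → List X}
    (hS : ∀ a b, b ∈ S a) {x : ℕ → X} (hx : IsImage S x x) : ∃ G, PairRecurrent x G := by
  classical
  obtain ⟨I, hI⟩ : ∃ I, ∀ i, ∃ j ≤ I, x j = x i ∧ x (j + 1) = x (i + 1) := by
    obtain ⟨I, hI⟩ := (Set.finite_range fun p : X × X => sInf {j | (x j, x (j + 1)) = p}).bddAbove
    refine ⟨I, fun i => ⟨_, hI ⟨(x i, x (i + 1)), rfl⟩, ?_⟩⟩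
    exact Prod.mk.inj (Nat.sInf_mem (s := {j | (x j, x (j + 1)) = (x i, x (i + 1))}) ⟨i, rfl⟩)
  have hone := isImage_singleton x
  set E : ℕ → X → List X := RichWords.level S fun a => [a] with hE
  have hEx : ∀ e, IsImage (E e) x x := fun e => hx.level hone e
  obtain ⟨e, he⟩ : ∃ e, I + 2 ≤ (E e (x 0)).length :=
    ⟨I + 2 + 1, (lt_totalLength_level hS (totalLength_pos hone) (I + 2)).le.trans
      (totalLength_le_length_level hS _ _ _)⟩
  have hne : NonErasing (E (e + 1)) := fun a => by
    have h1 := totalLength_le_length_level hS (fun a : X => [a]) e a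
    have h2 := totalLength_pos (hEx e)
    exact List.ne_nil_of_length_pos (h2.trans_le h1)
  have hp := (hEx (e + 1)).parsing hne
  refine ⟨2 * totalLength (E (e + 1)), fun i k => ?_⟩
  obtain ⟨κ, hκ1, hκ2⟩ := exists_between hp.zero hp.strictMono k
  obtain ⟨i₀, hi₀, h1, h2⟩ := hI i
  have hinf : E e (x 0) <:+: E (e + 1) (x (κ + 1)) := by
    obtain ⟨s, t, hst⟩ := List.append_of_mem (hS (x (κ + 1)) (x 0))
    refine ⟨s.flatMap (E e), t.flatMap (E e), ?_⟩
    simp [hE, RichWords.level, hst]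
  rw [(hEx (e + 1)).apply_eq (κ + 1), infix_factorAt_iff] at hinf
  obtain ⟨o, m, hom, heq⟩ := hinf
  have hm : (E e (x 0)).length = m := by rw [heq, length_factorAt]
  rw [(hEx e).apply_eq 0, imagePos_zero, hm] at heq
  have heq := factorAt_eq_iff.1 heq
  simp only [zero_add] at heq
  have h3 := imagePos_succ (E (e + 1)) x κ
  have h4 := length_le_totalLength (E (e + 1)) (x κ)
  have h5 := length_le_totalLength (E (e + 1)) (x (κ + 1))
  refine ⟨imagePos (E (e + 1)) x (κ + 1) + o + i₀, by omega, by omega, ?_, ?_⟩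
  · rw [← heq i₀ (by omega), h1]
  · rw [add_assoc, ← heq (i₀ + 1) (by omega), h2]

theorem IsImage.periodic [Subsingleton X] {f : X → List B} {x : ℕ → X} {y : ℕ → B}
    (h : IsImage f x y) : ∃ p, 0 < p ∧ ∀ k, y (k + p) = y k := by
  have hne : f (x 0) ≠ [] := by
    intro h0
    obtain ⟨n, hn⟩ := h.2 1
    have h1 : ∀ a, f a = [] := fun a => by rw [Subsingleton.elim a (x 0), h0]
    simp [h1] at hn
  have hp := h.parsing fun a => Subsingleton.elim (x 0) a ▸ hne
  refine ⟨(f (x 0)).length, List.length_pos_iff.2 hne, fun k => ?_⟩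
  obtain ⟨i, hi1, hi2⟩ := exists_between hp.zero hp.strictMono k
  have h1 := imagePos_succ f x i
  rw [Subsingleton.elim (x i) (x 0)] at h1
  have h2 := (hp.agree i (i + 1) (Subsingleton.elim _ _)).2
  exact (h2.eq (by omega) (by omega) (by omega)).symm

end

theorem IsPrimitiveMorphic.periodic_or_scalableParsing {A : Type*} {y : ℕ → A}
    (h : IsPrimitiveMorphic y) :
    (∃ p, 0 < p ∧ ∀ k, y (k + p) = y k) ∨
      ∃ (X : Type) (_ : Finite X) (x : ℕ → X) (L G : ℕ), ScalableParsing x y L ∧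
        PairRecurrent x G := by
  obtain ⟨X, _, f, x, ⟨τ, ⟨-, N, -, hN⟩, hx⟩, hf⟩ := h
  rcases subsingleton_or_nontrivial X with hX | hX
  · exact Or.inl hf.periodic
  · have := Fintype.ofFinite X
    have hx' := hx.iterate N
    obtain ⟨G, hG⟩ := hx'.pairRecurrent hN
    exact Or.inr ⟨X, inferInstance, x, _, G, hx'.scalableParsing hN hf, hG⟩

/-! ### The periodic case -/

theorem isRich_const {C : Type*} (a : C) : IsRich fun _ : ℕ => a :=
  PalReturns.isRich fun _ _ _ _ _ _ _ _ _ _ => rfl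

theorem isImage_of_periodic {B : Type*} {z : ℕ → B} {q : ℕ} (hq : 0 < q)
    (hz : ∀ k, z (k + q) = z k) : IsImage (fun _ : Unit => factorAt z 0 q) (fun _ => ()) z := by
  refine isImage_of_pos (pos := fun i => i * q) (zero_mul q)
    (fun i j hij => Nat.mul_le_mul_right q hij)
    (fun N => ⟨N, Nat.le_mul_of_pos_right N hq⟩) fun i => ?_
  simp only [add_mul, one_mul, Nat.add_sub_cancel_left]
  refine factorAt_eq_iff.2 fun t _ => ?_
  rw [zero_add, add_comm]
  induction i with
  | zero => simp
  | succ i ih => rw [add_mul, one_mul, ← add_assoc, hz, ih]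

/-- A palindromic prefix at least as long as the period shows that the period word is a product of
two palindromes; the word over the one-letter alphabet is fixed by `a ↦ aa`. -/
theorem exists_of_periodic {A : Type*} {y : ℕ → A} (hy : IsRich y) {p : ℕ} (hp : 0 < p)
    (hper : ∀ k, y (k + p) = y k) :
    ∃ (C : Type) (_ : Finite C) (g : C → List A) (x : ℕ → C),
      ClassPPrime g ∧ IsRich x ∧ FPPrime x ∧ IsImage g x y := by
  have hmul : ∀ i k, y (k + i * p) = y k := by
    intro i
    induction i with
    | zero => simp
    | succ i ih => intro k; rw [add_mul, one_mul, ← add_assoc, hper, ih]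
  have hrec : Recurrent y := fun n N =>
    ⟨N * p, Nat.le_mul_of_pos_right N hp, fun t _ => by rw [zero_add, add_comm, hmul]⟩
  obtain ⟨n, hn, hpal⟩ := hrec.exists_palindromic_prefix hy.palReturns p
  refine ⟨Unit, inferInstance, fun _ => factorAt y 0 p, fun _ => (), ?_, isRich_const _, ?_,
    isImage_of_periodic hp hper⟩
  · refine classPPrime_of_palindrome (w := factorAt y 0 n) (fun _ => ?_)
      (palindrome_factorAt.2 hpal) fun _ => ?_
    · exact List.ne_nil_of_length_pos (by simpa using hp)
    · have h1 : factorAt y 0 n = factorAt y (0 + p) n :=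
        factorAt_eq_iff.2 fun t _ => by rw [zero_add, zero_add, add_comm p, hper]
      rw [h1, factorAt_append]
      refine palindrome_factorAt.2 fun a b hab => ?_
      -- the mirror symmetry of the prefix of length `n ≥ p` extends by the period
      rcases Nat.lt_or_ge a n with ha | ha
      · rcases Nat.lt_or_ge b p with hb | hb
        · rw [← hper (0 + b)]
          rcases Nat.lt_or_ge a p with ha' | ha'
          · omega
          · rw [show 0 + a = (0 + (a - p)) + p by omega, hper, hper]
            exact hpal _ _ (by omega)
        · rw [show 0 + b = (0 + (b - p)) + p by omega, hper]
          exact hpal _ _ (by omega)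
      · rw [show 0 + a = (0 + (a - p)) + p by omega, hper]
        exact hpal _ _ (by omega)
  · refine ⟨fun _ => [(), ()], ⟨fun _ => by simp, 1, one_pos, fun _ _ => by simp⟩, ?_, ?_⟩
    · exact ⟨fun _ => [(), ()], ⟨fun _ => by simp, [], fun _ => [(), ()], List.Palindrome.nil,
        fun _ => List.Palindrome.of_reverse_eq rfl, fun _ => rfl⟩, [], Or.inl fun _ => by simp⟩
    · exact isImage_of_periodic (z := fun _ : ℕ => ()) (q := 2) two_pos fun _ => rfl

/-! ### The aperiodic case -/

/-- Two palindromic prefixes, of lengths `n` and `m ≫ n`, have the same derived sequence `u`. Then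
`y` is the image of `u` by the morphism that maps a letter to the return word it stands for, and `u`
is fixed by the substitution that writes the return words to the long prefix in terms of those to
the short one. -/
theorem exists_of_aperiodic {A : Type*} {y : ℕ → A} (hrich : IsRich y) (hap : Aperiodic y)
    {X : Type*} [Finite X] {x : ℕ → X} {K L : ℕ} (hy : LinearlyRecurrent y K)
    (hx : ScalableParsing x y L) :
    ∃ (C : Type) (_ : Finite C) (g : C → List A) (x : ℕ → C),
      ClassPPrime g ∧ IsRich x ∧ FPPrime x ∧ IsImage g x y := by
  have hpr := hrich.palReturns
  have hr := hy.recurrent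
  obtain ⟨n, hn, hpn, hinf⟩ := hy.exists_derived_eq_derived hap hx hpr
  -- return words to a prefix of this length `m` are longer than `K * ((K + 1) * n)`
  obtain ⟨m, hm, hpm, hD⟩ := hinf (K * (K * ((K + 1) * n) + 1) + n)
  have hgap : ∀ k, cut y m k + K * ((K + 1) * n) < cut y m (k + 1) := by
    intro k
    have h1 := hy.lt_return hap m k
    have h2 := hr.cut_lt m k
    have h3 : K * (K * ((K + 1) * n) + 1) < K * (cut y m (k + 1) - cut y m k + 1) := by omega
    have h4 := Nat.lt_of_mul_lt_mul_left h3
    omega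
  have hnm : n ≤ m := by omega
  -- `ν` lists the indices of the occurrences of the short prefix that begin long ones
  have hν : ∀ k, ∃ j, cut y n j = cut y m k := fun k =>
    exists_cut_eq ((hr.agree_cut m k).mono hnm)
  choose ν hν using hν
  have hνmono : StrictMono ν := fun i j hij => by
    rw [← (hr.cut_strictMono n).lt_iff_lt, hν, hν]
    exact hr.cut_strictMono m hij
  have hν0 : ν 0 = 0 := by
    apply (hr.cut_strictMono n).injective
    rw [hν, cut_zero, cut_zero]
  -- the last occurrence of the short prefix in the long one
  obtain ⟨l, hl⟩ : ∃ l, cut y n l = m - n := by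
    refine exists_cut_eq fun t ht => ?_
    calc y (m - n + t) = y (0 + (n - 1 - t)) := hpm.eq (by omega) (by omega) (by omega)
      _ = y (0 + t) := hpn _ _ (by omega)
  let C := Set.range (derived y n)
  have hC : Finite C := ((Set.finite_Iic (2 * K * (K * (K + 1)))).subset (by
    rintro _ ⟨k, rfl⟩
    exact hy.derived_le hap hn k)).to_subtype
  let u : ℕ → C := fun k => ⟨derived y n k, k, rfl⟩
  have hu : ∀ i j, u i = u j ↔ derived y n i = derived y n j := fun i j => Subtype.ext_iff
  have hidem : ∀ a : C, derived y n a = a := by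
    rintro ⟨_, k, rfl⟩
    exact derived_derived y n k
  have hidem' : ∀ k, derived y n (u k) = derived y n k := fun k => derived_derived y n k
  have hpalu : ∀ i k, PalAt u i k ↔ PalAt (derived y n) i k := fun i k => by
    simp only [PalAt, hu]
  have hagu : ∀ i j k, Agree u i j k ↔ Agree (derived y n) i j k := fun i j k => by
    simp only [Agree, hu]
  have hurich : IsRich u := by
    refine PalReturns.isRich fun i d k => ?_
    simp only [hpalu, hagu]
    exact hr.palReturns_derived hpr hpn i d k
  -- equal return words to the long prefix are written equally in terms of the short one
  have hlong : ∀ i j, derived y n i = derived y n j →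
      ν (i + 1) + ν j = ν (j + 1) + ν i ∧ Agree u (ν i) (ν j) (ν (i + 1) - ν i) := by
    intro i j hij
    rw [← hD] at hij
    obtain ⟨h1, h2⟩ := hr.agree_of_derived (n := m) (m := 1) (i := i) (j := j) fun t ht => by
      obtain rfl : t = 0 := by omega
      exact hij
    have h3 := hνmono i.lt_add_one
    have h4 := hr.cut_lt m i
    rw [← hν i, ← hν j, ← hν (i + 1), ← hν (j + 1)] at h1
    rw [← hν i, ← hν j, ← hν (i + 1)] at h2
    rw [← hν i, ← hν (i + 1)] at h4
    obtain ⟨q, hq1, hq2, hq3⟩ := hr.derived_of_agree (n := n) (i := ν i) (m := ν (i + 1) - ν i)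
      (q := cut y n (ν j)) (by
        rw [show ν i + (ν (i + 1) - ν i) = ν (i + 1) by omega]
        exact h2.symm.mono (by omega))
    obtain rfl := (hr.cut_strictMono n).injective hq1
    have h5 := hq2 _ le_rfl
    rw [show ν i + (ν (i + 1) - ν i) = ν (i + 1) by omega] at h5
    have h6 : ν j + (ν (i + 1) - ν i) = ν (j + 1) :=
      (hr.cut_strictMono n).injective (by omega)
    exact ⟨by omega, (hagu _ _ _).2 hq3.symm⟩
  refine ⟨C, hC, fun a => block y n a, u, ?_, hurich, ?_, ?_⟩
  · refine classPPrime_of_palindrome (w := factorAt y 0 n) (fun a => ?_)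
      (palindrome_factorAt.2 hpn) fun a => ?_
    · have := hr.cut_lt n a
      exact List.ne_nil_of_length_pos (by rw [block, length_factorAt]; omega)
    · have h1 : factorAt y 0 n =
          factorAt y (cut y n a + (cut y n (a + 1) - cut y n a)) n := by
        have := hr.cut_lt n a
        rw [show cut y n a + (cut y n (a + 1) - cut y n a) = cut y n (a + 1) by omega]
        exact factorAt_eq_iff.2 (hr.agree_cut n (a + 1)).symm
      rw [h1, block, factorAt_append]
      exact palindrome_factorAt.2 (hr.palAt_block hpr hpn a)
  · refine ⟨fun a => factorAt u (ν a) (ν (a + 1) - ν a), ⟨fun a => ?_, 1, one_pos, fun a b => ?_⟩,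
      ?_, ?_⟩
    · have := hνmono (a : ℕ).lt_add_one
      exact List.ne_nil_of_length_pos (by rw [length_factorAt]; omega)
    · -- the return word `a` to the long prefix is long enough to contain all the short ones
      obtain ⟨j, hj1, hj2, hj3⟩ := hy.exists_derived_eq hn b (cut y m a)
      have h1 := hgap a
      have h2 : ν a ≤ j := (hr.cut_strictMono n).le_iff_le.1 (by rw [hν]; exact hj1)
      have h3 : j + 1 ≤ ν (a + 1) := (hr.cut_strictMono n).le_iff_le.1 (by rw [hν]; omega)
      simp only [Function.iterate_one, List.flatMap_singleton]
      refine mem_factorAt.2 ⟨j - ν a, by omega, Subtype.ext ?_⟩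
      rw [show ν a + (j - ν a) = j by omega, ← hidem b, ← hj3]
    · -- both words below code palindromes: the long prefix, and a complete return to it
      have hcodes : ∀ k, Agree u (ν k) 0 l ∧ cut y n (ν k + l) = cut y m k + (m - n) := by
        intro k
        obtain ⟨q, hq1, hq2, hq3⟩ := hr.derived_of_agree (n := n) (i := 0) (m := l)
          (q := cut y m k) (by
            rw [zero_add, cut_zero, hl]
            exact (hr.agree_cut m k).mono (by omega))
        obtain rfl : ν k = q := (hr.cut_strictMono n).injective ((hν k).trans hq1)
        have h1 := hq2 l le_rfl
        rw [zero_add, cut_zero, hl] at h1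
        exact ⟨(hagu _ _ _).2 hq3, by omega⟩
      refine classPPrime_of_palindrome (w := factorAt u 0 l) (fun a => ?_) ?_ fun a => ?_
      · have := hνmono (a : ℕ).lt_add_one
        exact List.ne_nil_of_length_pos (by rw [length_factorAt]; omega)
      · refine palindrome_factorAt.2 ((hpalu _ _).2 (hr.palAt_derived hpr hpn ?_))
        rw [zero_add, cut_zero, hl, show m - n - 0 + n = m by omega]
        exact hpm
      · have h1 := hνmono (a : ℕ).lt_add_one
        have h2 := hr.cut_lt m a
        have h3 : factorAt u 0 l = factorAt u (ν a + (ν (a + 1) - ν a)) l := by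
          rw [show ν a + (ν (a + 1) - ν a) = ν (a + 1) by omega]
          exact factorAt_eq_iff.2 (hcodes (a + 1)).1.symm
        rw [h3, factorAt_append]
        refine palindrome_factorAt.2 ((hpalu _ _).2 (hr.palAt_derived hpr hpn ?_))
        rw [show ν a + (ν (a + 1) - ν a + l) = ν (a + 1) + l by omega, (hcodes (a + 1)).2, hν,
          show cut y m (a + 1) + (m - n) - cut y m a + n = cut y m (a + 1) - cut y m a + m by omega]
        exact hr.palAt_block hpr hpm a
    · refine isImage_of_pos hν0 hνmono.monotone (fun N => ⟨N, hνmono.le_apply⟩) fun k => ?_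
      obtain ⟨h1, h2⟩ := hlong (u k) k (hidem' k)
      have h3 := hνmono (u k : ℕ).lt_add_one
      have h4 := hνmono k.lt_add_one
      rw [show ν (k + 1) - ν k = ν (u k + 1) - ν (u k) by omega]
      exact factorAt_eq_iff.2 h2
  · refine isImage_of_pos (cut_zero y n) (hr.cut_strictMono n).monotone
      (fun N => ⟨N, (hr.cut_strictMono n).le_apply⟩) fun k => ?_
    exact block_derived y n k

end RichWords

theorem mainTheorem2 {A : Type*} [Finite A] (y : ℕ → A)
    (hrich : RichWords.IsRich y) (hmorphic : RichWords.IsPrimitiveMorphic y) :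
    ∃ (C : Type) (_ : Finite C) (g : C → List A) (x : ℕ → C),
      RichWords.ClassPPrime g ∧ RichWords.IsRich x ∧ RichWords.FPPrime x ∧
        RichWords.IsImage g x y := by
  by_cases hper : ∃ p, 0 < p ∧ ∀ k, y (k + p) = y k
  · obtain ⟨p, hp, hper⟩ := hper
    exact RichWords.exists_of_periodic hrich hp hper
  · obtain ⟨X, _, x, L, G, hL, hG⟩ := hmorphic.periodic_or_scalableParsing.resolve_left hper
    exact RichWords.exists_of_aperiodic hrich (fun p hp h => hper ⟨p, hp, h⟩)
      (hL.linearlyRecurrent hG) hL
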